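/- Let $\mathfrak g$ be a finite-dimensional real Lie algebra with bracket $\mu_{\mathfrak g}=[\cdot,\cdot]$, let $\mathfrak i\lhd\mathfrak g$ be an ideal, and let $k=\dim\mathfrak i$. Let $\mathrm{Gr}_k(\mathfrak g)$ be the Grassmannian of $k$-dimensional linear subspaces of $\mathfrak g$, let $\mathbf I_k(\mathfrak g)\subset \mathrm{Gr}_k(\mathfrak g)$ be the set of $k$-dimensional ideals of $(\mathfrak g,\mu_{\mathfrak g})$, and let $\Lambda\subset\mathrm{Hom}(\wedge^2\mathfrak g,\mathfrak g)$ be the space of all Lie brackets on the vector space $\mathfrak g$, with the subspace topology. Let $\mathfrak g$ act on $\mathrm{Hom}(\mathfrak i,\mathfrak g/\mathfrak i)$ by $(x\cdot\phi)(u)=\overline{[x,\widetilde{\phi(u)}]}-\phi([x,u])$, where $\widetilde{\phi(u)}\in\mathfrak g$ is any lift of $\phi(u)$, and let $Z^0(\mathfrak i\lhd\mathfrak g)$, $H^0(\mathfrak i\lhd\mathfrak g)=Z^0(\mathfrak i\lhd\mathfrak g)$ and $H^1(\mathfrak i\lhd\mathfrak g)$ be the $0$-cocycles and the Chevalley-Eilenberg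 cohomology of $\mathfrak g$ with values in this representation. Identify $T_{\mathfrak i}\mathrm{Gr}_k(\mathfrak g)$ with $\mathrm{Hom}(\mathfrak i,\mathfrak g/\mathfrak i)$ in the canonical way. Suppose that $H^1(\mathfrak i\lhd\mathfrak g)=0$. Then: 1. $\mathfrak i$ is topologically stable: for each neighbourhood $U$ of $\mathfrak i$ in $\mathrm{Gr}_k(\mathfrak g)$ there is a neighbourhood $N$ of $\mu_{\mathfrak g}$ in $\Lambda$ such that for every $\mu'\in N$ there is $\mathfrak i'\in U$ that is an ideal of the Lie algebra $(\mathfrak g,\mu')$. 2. Locally around $\mathfrak i$, the set $\mathbf I_k(\mathfrak g)$ is a smooth (embedded) submanifold of $\mathrm{Gr}_k(\mathfrak g)$, of dimension $\dim Z^0(\mathfrak i\lhd\mathfrak g)$. 3. The tangent space of $\mathbf I_k(\mathfrak g)$ at $\mathfrak i$ is $Z^0(\mathfrak i\lhd\mathfrak g)\subseteq \mathrm{Hom}(\mathfrak i,\mathfrak g/\mathfrak i)$. 4. Each infinitesimal deformation of $\mathfrak i$ is a deformation class: for every $\eta\in H^0(\mathfrak i\lhd\mathfrak g)=Z^0(\mathfrak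 i\lhd\mathfrak g)$ there is a smooth curve $[0,1]\to\mathrm{Gr}_k(\mathfrak g)$, $t\mapsto\mathfrak i_t$, of ideals of $\mathfrak g$ with $\mathfrak i_0=\mathfrak i$ and $\frac{d}{dt}\big|_{t=0}\mathfrak i_t=\eta$. -/

import Mathlib

open scoped ContDiff Topology

namespace IdealStability

/-! ### The canonical topology and smooth structure of a finite-dimensional real vector space

All norms on a finite-dimensional real vector space are equivalent, so the topology and the notion
of smooth map do not depend on the choice of norm. The norm used here is the one that is carried
over from `Fin n → ℝ` by a choice of basis. -/

section FiniteDim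

variable (E : Type*) [AddCommGroup E] [Module ℝ E] [FiniteDimensional ℝ E]

/-- A norm on a finite-dimensional real vector space, from coordinates in a basis. -/
@[reducible] noncomputable def fdNormedAddCommGroup : NormedAddCommGroup E :=
  NormedAddCommGroup.induced E (Fin (Module.finrank ℝ E) → ℝ)
    (Module.finBasis ℝ E).equivFun (Module.finBasis ℝ E).equivFun.injective

/-- The real normed space structure that belongs to `fdNormedAddCommGroup`. -/
@[reducible] noncomputable def fdNormedSpace :
    letI := fdNormedAddCommGroup E
    NormedSpace ℝ E :=
  NormedSpace.induced ℝ E (Fin (Module.finrank ℝ E) → ℝ) (Module.finBasis ℝ E).equivFun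

/-- The canonical topology of a finite-dimensional real vector space. -/
@[reducible] noncomputable def fdTopology : TopologicalSpace E :=
  (fdNormedAddCommGroup E).toPseudoMetricSpace.toUniformSpace.toTopologicalSpace

variable {E}

/-- The curve `φ : ℝ → E` is smooth on the set `s`. -/
def SmoothOn (φ : ℝ → E) (s : Set ℝ) : Prop :=
  letI := fdNormedAddCommGroup E
  letI := fdNormedSpace E
  ContDiffOn ℝ ∞ φ s

/-- The curve `φ : ℝ → E` has derivative `v` at `t`, relative to the set `s`. -/
def HasVelocity (φ : ℝ → E) (v : E) (s : Set ℝ) (t : ℝ) : Prop :=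
  letI := fdNormedAddCommGroup E
  letI := fdNormedSpace E
  HasDerivWithinAt φ v s t

/-- The subset `S` of `E` is, in a neighbourhood of its point `p`, an embedded smooth submanifold
of dimension `d`: there is a diffeomorphism `e` from an open neighbourhood of `p` onto an open
subset of `E` that straightens `S` to a linear subspace of dimension `d`. -/
def IsSubmanifoldNear (S : Set E) (p : E) (d : ℕ) : Prop :=
  letI := fdNormedAddCommGroup E
  letI := fdNormedSpace E
  p ∈ S ∧ ∃ (e : OpenPartialHomeomorph E E) (F : Submodule ℝ E),
    p ∈ e.source ∧ ContDiffOn ℝ ∞ e e.source ∧ ContDiffOn ℝ ∞ e.symm e.target ∧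
    Module.finrank ℝ F = d ∧ ∀ x ∈ e.source, x ∈ S ↔ e x ∈ F

end FiniteDim

/-! ### The Grassmannian -/

section Grassmannian

variable {V : Type*} [AddCommGroup V] [Module ℝ V] {k : ℕ}

/-- The Grassmannian of `k`-dimensional linear subspaces of `V`. -/
def Gr (k : ℕ) (V : Type*) [AddCommGroup V] [Module ℝ V] : Type _ :=
  {W : Submodule ℝ V // Module.finrank ℝ W = k}

/-- The linear map `w ↦ w + φ w`, whose range is the graph of `φ : W → W'` in `V`. -/
def graphMap (W W' : Submodule ℝ V) (φ : W →ₗ[ℝ] W') : W →ₗ[ℝ] V :=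
  W.subtype + W'.subtype ∘ₗ φ

theorem graphMap_injective {W W' : Submodule ℝ V} (h : IsCompl W W') (φ : W →ₗ[ℝ] W') :
    Function.Injective (graphMap W W' φ) := by
  rw [← LinearMap.ker_eq_bot, LinearMap.ker_eq_bot']
  intro w hw
  have h1 : (w : V) = -(φ w : V) := by
    simpa [graphMap] using eq_neg_of_add_eq_zero_left hw
  have h2 : (w : V) ∈ W ⊓ W' := ⟨w.2, by rw [h1]; exact W'.neg_mem (φ w).2⟩
  rw [h.inf_eq_bot] at h2
  exact Subtype.ext h2

/-- The (inverse) chart of the Grassmannian that belongs to the decomposition `V = W ⊕ W'`, sending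
a linear map `φ : W → W'` to its graph. It is centred at `W`. -/
def grChart (W : Gr k V) (W' : Submodule ℝ V) (h : IsCompl W.1 W') (φ : W.1 →ₗ[ℝ] W') : Gr k V :=
  ⟨LinearMap.range (graphMap W.1 W' φ),
    (LinearMap.finrank_range_of_inj (graphMap_injective h φ)).trans W.2⟩

variable [FiniteDimensional ℝ V]

/-- The topology of the Grassmannian: a set is open iff its preimage in every chart is open. -/
noncomputable instance : TopologicalSpace (Gr k V) :=
  ⨆ (W : Gr k V) (W' : Submodule ℝ V) (h : IsCompl W.1 W'),
    TopologicalSpace.coinduced (grChart W W' h) (fdTopology (W.1 →ₗ[ℝ] W'))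

/-- The curve `γ` in the Grassmannian is smooth on the set `s`: around each point of `s` it is
smooth in some chart. -/
def GrSmoothOn (γ : ℝ → Gr k V) (s : Set ℝ) : Prop :=
  ∀ t₀ ∈ s, ∃ (W : Gr k V) (W' : Submodule ℝ V) (h : IsCompl W.1 W') (φ : ℝ → (W.1 →ₗ[ℝ] W')),
    ∃ u ∈ 𝓝 t₀, SmoothOn φ (s ∩ u) ∧ ∀ t ∈ s ∩ u, γ t = grChart W W' h (φ t)

/-- The curve `γ` in the Grassmannian, considered on the set `s` of parameters, satisfies `γ 0 = W`
and has velocity `η` at the parameter `0`, where the tangent space of the Grassmannian at `W` is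
identified with `Hom(W, V ⧸ W)`: if `V = W ⊕ W'` and `γ t` is the graph of `φ t : W → W'` for `t`
near `0`, then `η` is the derivative of `φ` at `0` followed by `W' → V ⧸ W`. -/
def GrHasVelocity (γ : ℝ → Gr k V) (s : Set ℝ) (W : Gr k V) (η : W.1 →ₗ[ℝ] V ⧸ W.1) : Prop :=
  γ 0 = W ∧ ∃ (W' : Submodule ℝ V) (h : IsCompl W.1 W') (φ : ℝ → (W.1 →ₗ[ℝ] W'))
    (v : W.1 →ₗ[ℝ] W'),
    (∀ᶠ t in 𝓝[s] 0, γ t = grChart W W' h (φ t)) ∧ φ 0 = 0 ∧ HasVelocity φ v s 0 ∧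
    η = W.1.mkQ ∘ₗ W'.subtype ∘ₗ v

/-- The subset `S` of the Grassmannian is, in a neighbourhood of its point `W`, an embedded smooth
submanifold of dimension `d`: it is so in every chart centred at `W`. -/
def GrIsSubmanifoldNear (S : Set (Gr k V)) (W : Gr k V) (d : ℕ) : Prop :=
  W ∈ S ∧ ∀ (W' : Submodule ℝ V) (h : IsCompl W.1 W'),
    IsSubmanifoldNear (grChart W W' h ⁻¹' S) 0 d

/-- The tangent space at `W` of a subset `S` of the Grassmannian that is a submanifold near `W`, as
a set of tangent vectors of the Grassmannian: the velocities at time `0` of the smooth curves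
`(-ε, ε) → S` through `W`. -/
def grTangentSpace (S : Set (Gr k V)) (W : Gr k V) : Set (W.1 →ₗ[ℝ] V ⧸ W.1) :=
  {η | ∃ (γ : ℝ → Gr k V) (ε : ℝ), 0 < ε ∧ GrSmoothOn γ (Set.Ioo (-ε) ε) ∧
    (∀ t ∈ Set.Ioo (-ε) ε, γ t ∈ S) ∧ GrHasVelocity γ (Set.Ioo (-ε) ε) W η}

end Grassmannian

/-! ### The space of Lie brackets on a vector space -/

section Brackets

/-- The space of Lie brackets on the real vector space `V`. -/
def LieBracket (V : Type*) [AddCommGroup V] [Module ℝ V] : Type _ :=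
  {μ : V →ₗ[ℝ] V →ₗ[ℝ] V //
    (∀ x, μ x x = 0) ∧ ∀ x y z, μ x (μ y z) = μ (μ x y) z + μ y (μ x z)}

/-- The topology of the space of Lie brackets, as a subspace of the bilinear maps. -/
noncomputable instance (V : Type*) [AddCommGroup V] [Module ℝ V] [FiniteDimensional ℝ V] :
    TopologicalSpace (LieBracket V) :=
  TopologicalSpace.induced Subtype.val (fdTopology (V →ₗ[ℝ] V →ₗ[ℝ] V))

/-- The set of `k`-dimensional ideals of the Lie algebra `(V, μ)`. -/
def idealsOf {V : Type*} [AddCommGroup V] [Module ℝ V] (μ : LieBracket V) (k : ℕ) :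
    Set (Gr k V) :=
  {W | ∀ x, ∀ w ∈ W.1, μ.1 x w ∈ W.1}

variable (L : Type*) [LieRing L] [LieAlgebra ℝ L]

/-- The bracket of a Lie algebra, as a point of the space of Lie brackets on its vector space. -/
def bracketOf : LieBracket L :=
  ⟨LinearMap.mk₂ ℝ (fun x y => ⁅x, y⁆) add_lie smul_lie lie_add lie_smul,
    fun x => by simp, fun x y z => by simp⟩

variable {L}

/-- An ideal of a Lie algebra, as a point of the Grassmannian. -/
def grPoint (I : LieIdeal ℝ L) : Gr (Module.finrank ℝ I) L :=
  ⟨I.toSubmodule, rfl⟩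

end Brackets

/-! ### Cohomology in low degrees -/

section Cohomology

variable (L : Type*) [LieRing L] [LieAlgebra ℝ L]
variable (M : Type*) [AddCommGroup M] [Module ℝ M] [LieRingModule L M] [LieModule ℝ L M]

/-- The Chevalley-Eilenberg differential in degree zero. The one in degree one is
`LieModule.Cohomology.d₁₂`. -/
def d₀₁ : M →ₗ[ℝ] LieModule.Cohomology.oneCochain ℝ L M :=
  LinearMap.mk₂ ℝ (fun m x => ⁅x, m⁆) (fun _ _ _ => lie_add _ _ _) (fun _ _ _ => lie_smul _ _ _)
    (fun _ _ _ => add_lie _ _ _) (fun _ _ _ => smul_lie _ _ _)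

theorem d₁₂_comp_d₀₁ : LieModule.Cohomology.d₁₂ ℝ L M ∘ₗ d₀₁ L M = 0 := by
  ext m x y
  simp [d₀₁]

/-- The `0`-cocycles of `L` with coefficients in `M`. -/
def zeroCocycles : Submodule ℝ M := LinearMap.ker (d₀₁ L M)

/-- The `1`-cocycles of `L` with coefficients in `M`. -/
def oneCocycles : Submodule ℝ (LieModule.Cohomology.oneCochain ℝ L M) :=
  LinearMap.ker (LieModule.Cohomology.d₁₂ ℝ L M)

/-- The first Chevalley-Eilenberg cohomology of `L` with coefficients in `M`: the `1`-cocycles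
modulo the `1`-coboundaries. -/
abbrev cohomologyOne : Type _ :=
  oneCocycles L M ⧸ (LinearMap.range (d₀₁ L M)).submoduleOf (oneCocycles L M)

end Cohomology

section Deformations

variable {L : Type*} [LieRing L] [LieAlgebra ℝ L]

/-- `Z⁰(I ◁ L)`, with coefficients in `Hom(I, L ⧸ I)`, on which `x` acts by
`(x φ)(u) = [x, φ u] - φ [x, u]`. Because there are no coboundaries in degree zero, it is also
`H⁰(I ◁ L)`, the space of infinitesimal deformations of `I`. -/
abbrev idealZ0 (I : LieIdeal ℝ L) : Submodule ℝ (I →ₗ[ℝ] L ⧸ I) := zeroCocycles L (I →ₗ[ℝ] L ⧸ I)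

/-- `H¹(I ◁ L)`, with coefficients in `Hom(I, L ⧸ I)`. -/
abbrev idealH1 (I : LieIdeal ℝ L) : Type _ := cohomologyOne L (I →ₗ[ℝ] L ⧸ I)

variable [FiniteDimensional ℝ L]

/-- The ideal `I` is topologically stable: each neighbourhood `U` of `I` in the Grassmannian
contains, for all Lie brackets `μ` close enough to the one of `L`, an ideal of `(L, μ)`. -/
def IsTopologicallyStable (I : LieIdeal ℝ L) : Prop :=
  ∀ U ∈ 𝓝 (grPoint I), ∃ N ∈ 𝓝 (bracketOf L), ∀ μ ∈ N, ∃ J ∈ U,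
    J ∈ idealsOf μ (Module.finrank ℝ I)

/-- The curve `γ`, considered on `[0, 1]`, is a smooth deformation of the ideal `I` as an ideal. -/
structure IsSmoothDeformation (I : LieIdeal ℝ L) (γ : ℝ → Gr (Module.finrank ℝ I) L) : Prop where
  smooth : GrSmoothOn γ (Set.Icc 0 1)
  start : γ 0 = grPoint I
  ideal : ∀ t ∈ Set.Icc (0 : ℝ) 1, γ t ∈ idealsOf (bracketOf L) (Module.finrank ℝ I)

/-- The infinitesimal deformation `η` is a deformation class: it is the velocity at time `0` of a
smooth deformation of `I`. -/
def IsDeformationClass (I : LieIdeal ℝ L) (η : I →ₗ[ℝ] L ⧸ I) : Prop :=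
  ∃ γ : ℝ → Gr (Module.finrank ℝ I) L, IsSmoothDeformation I γ ∧
    GrHasVelocity γ (Set.Icc 0 1) (grPoint I) η

end Deformations

end IdealStability

open IdealStability

/-! Fix a complement `W'` of the ideal. In the chart `φ ↦ graph φ`, being an ideal of `(V, μ)` is
one equation `Φ(μ, φ) = 0`, where the `obstruction` `Φ(μ, φ)` takes `(x, u)` to the `W'`-component,
along the graph, of `μ x (u + φ u)`. The Jacobi identity gives a Bianchi-type relation `D(μ, φ) Φ(μ,
φ) = 0` (`obstructionD_obstruction`). At the given bracket and `φ = 0`, the derivative `d` of `Φ` in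
`φ` is the Chevalley-Eilenberg differential in degree zero and `D` is the one in degree one, so `H¹
= 0` says `ker D = im d`.

The derivative `d` need not be surjective, so the implicit function theorem does not apply to `Φ`
itself. Choose `h` with `d h d = d` and study `x - h d x + h Φ(p, x)`, whose `x`-derivative at the
base point is the identity. Applying `d` to it leaves `d h Φ(p, x)`. By exactness, `D` and `d h`
have no common kernel at the base point, hence none nearby; with `D Φ = 0`, the vanishing of `d h Φ`
forces `Φ = 0`. For varying `p` this gives stability (`eventually_exists_zero`). For fixed `p` it
straightens the zero set to `ker d ≅ Z⁰` (`exists_straightening`), which gives the submanifold and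
the curves (`exists_curve`). -/

namespace IdealStability

/-! ### Zeros of maps with an exact linearized complex -/

section Straightening

/-- Every linear map between vector spaces has a generalized inverse. -/
theorem exists_generalizedInverse {E F : Type*} [AddCommGroup E] [Module ℝ E] [AddCommGroup F]
    [Module ℝ F] (d : E →ₗ[ℝ] F) : ∃ h : F →ₗ[ℝ] E, ∀ x, d (h (d x)) = d x := by
  obtain ⟨s, hs⟩ := d.rangeRestrict.exists_rightInverse_of_surjective d.range_rangeRestrict
  obtain ⟨h, hh⟩ := LinearMap.exists_extend s
  refine ⟨h, fun x => ?_⟩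
  have h1 : h (d x) = s (d.rangeRestrict x) := LinearMap.congr_fun hh (d.rangeRestrict x)
  have h2 := congrArg Subtype.val (LinearMap.congr_fun hs (d.rangeRestrict x))
  rw [h1]
  exact h2

/-- If the linear operators `D z` depend continuously on `z` and the kernel of `D z₀` is contained
in the image of `d`, then near `z₀` the kernel of `D z` meets the kernel of `d ∘ h` trivially, for
a generalized inverse `h` of `d`. -/
theorem eventually_eq_zero_of_ker_le {E C₁ C₂ : Type*} [AddCommGroup E] [Module ℝ E]
    [NormedAddCommGroup C₁] [NormedSpace ℝ C₁] [FiniteDimensional ℝ C₁]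
    [NormedAddCommGroup C₂] [NormedSpace ℝ C₂] {X : Type*} [TopologicalSpace X] (D : X → C₁ →ₗ[ℝ] C₂)
    (hD : ∀ c, Continuous fun z => D z c) (z₀ : X) (d : E →ₗ[ℝ] C₁)
    (hker : ∀ c, D z₀ c = 0 → ∃ x, d x = c) (h : C₁ →ₗ[ℝ] E) (hh : ∀ x, d (h (d x)) = d x) :
    ∀ᶠ z in 𝓝 z₀, ∀ c, D z c = 0 → d (h c) = 0 → c = 0 := by
  -- The claim is injectivity of `c ↦ (D z c, d (h c))`, an open condition since `C₁` is
  -- finite-dimensional.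
  let T : X → C₁ →L[ℝ] C₂ × C₁ := fun z => LinearMap.toContinuousLinearMap ((D z).prod (d ∘ₗ h))
  have hT : Continuous T := by
    rw [continuous_clm_apply]
    intro c
    exact (hD c).prodMk continuous_const
  have hopen : IsOpen {L : C₁ →L[ℝ] C₂ × C₁ | Function.Injective L} :=
    ContinuousLinearMap.isOpen_injective
  have h0 : Function.Injective (T z₀) := by
    rw [injective_iff_map_eq_zero]
    intro c hc
    obtain ⟨hc1, hc2⟩ := Prod.mk.inj hc
    obtain ⟨x, rfl⟩ := hker c hc1
    rw [← hh x]
    exact hc2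
  filter_upwards [(hopen.preimage hT).mem_nhds h0] with z hz c hc1 hc2
  have : Function.Injective (T z) := hz
  refine (injective_iff_map_eq_zero (T z)).1 this c ?_
  exact Prod.ext hc1 hc2

variable {P E C₁ C₂ : Type*}
  [NormedAddCommGroup P] [NormedSpace ℝ P]
  [NormedAddCommGroup E] [NormedSpace ℝ E] [FiniteDimensional ℝ E]
  [NormedAddCommGroup C₁] [NormedSpace ℝ C₁] [FiniteDimensional ℝ C₁]
  [NormedAddCommGroup C₂] [NormedSpace ℝ C₂]

variable (Φ : P × E → C₁) (hΦ : ContDiff ℝ ∞ Φ) (p₀ : P) (hΦ0 : Φ (p₀, 0) = 0)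
  (d : E →ₗ[ℝ] C₁) (hd : ∀ v, fderiv ℝ Φ (p₀, 0) (0, v) = d v)
  (D : P × E → C₁ →ₗ[ℝ] C₂) (hD : ∀ c, Continuous fun z => D z c)
  (hker : ∀ c, D (p₀, 0) c = 0 → ∃ x, d x = c)

include hΦ hd hΦ0 hD hker

/-- Stability of the zero `0` of `Φ (p₀, ·)` under variation of the parameter `p₀`. -/
theorem eventually_exists_zero [CompleteSpace P] (Λ : Set P)
    (hDΦ : ∀ p ∈ Λ, ∀ x, D (p, x) (Φ (p, x)) = 0)
    {U : Set E} (hU : U ∈ 𝓝 0) : ∀ᶠ p in 𝓝 p₀, p ∈ Λ → ∃ x ∈ U, Φ (p, x) = 0 := by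
  obtain ⟨h, hh⟩ := exists_generalizedInverse d
  let hc : C₁ →L[ℝ] E := LinearMap.toContinuousLinearMap h
  let dc : E →L[ℝ] C₁ := LinearMap.toContinuousLinearMap d
  -- Keeping `p` as a component lets the local image of `G` contain all `(p, 0)` with `p` near `p₀`.
  let G : P × E → P × E := fun z => (z.1, z.2 - hc (dc z.2) + hc (Φ z))
  have hG : ContDiff ℝ ∞ G := by
    refine contDiff_fst.prodMk (ContDiff.add (ContDiff.sub contDiff_snd ?_) ?_)
    · exact hc.contDiff.comp (dc.contDiff.comp contDiff_snd)
    · exact hc.contDiff.comp hΦ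
  have hΦ' : HasStrictFDerivAt Φ (fderiv ℝ Φ (p₀, 0)) (p₀, 0) :=
    hΦ.contDiffAt.hasStrictFDerivAt (by simp)
  set G' : P × E →L[ℝ] P × E := (ContinuousLinearMap.fst ℝ P E).prod
    (ContinuousLinearMap.snd ℝ P E - hc ∘L dc ∘L ContinuousLinearMap.snd ℝ P E
      + hc ∘L fderiv ℝ Φ (p₀, 0)) with hG'
  have hGd : HasStrictFDerivAt G G' (p₀, 0) := by
    refine (hasStrictFDerivAt_fst).prodMk (HasStrictFDerivAt.add (HasStrictFDerivAt.sub
      hasStrictFDerivAt_snd ?_) ?_)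
    · exact (hc ∘L dc ∘L ContinuousLinearMap.snd ℝ P E).hasStrictFDerivAt
    · exact hc.hasStrictFDerivAt.comp _ hΦ'
  have hsurj : G'.range = ⊤ := by
    rw [LinearMap.range_eq_top]
    rintro ⟨p, x⟩
    -- The terms `h d` cancel, so the derivative is `(p, y) ↦ (p, y + h (∂ₚΦ p))`, which is solved
    -- for `y` directly.
    refine ⟨(p, x - hc (fderiv ℝ Φ (p₀, 0) (p, 0))), ?_⟩
    have key : ∀ y : E, fderiv ℝ Φ (p₀, 0) (p, y) = fderiv ℝ Φ (p₀, 0) (p, 0) + d y := by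
      intro y
      rw [← hd, ← map_add]
      simp
    have hdc : ∀ y, dc y = d y := fun _ => rfl
    simp [hG', key (x - _), hdc]
  have hG0 : G (p₀, 0) = (p₀, 0) := by simp [G, hΦ0]
  have hmap := hGd.map_nhds_eq_of_surj hsurj
  rw [hG0] at hmap
  have hev := eventually_eq_zero_of_ker_le D hD (p₀, 0) d hker h hh
  have hnhd : {z : P × E | z.2 ∈ U ∧ ∀ c, D z c = 0 → d (h c) = 0 → c = 0} ∈ 𝓝 (p₀, (0 : E)) := by
    filter_upwards [hev, continuousAt_snd.preimage_mem_nhds hU] with z h1 h2 using ⟨h2, h1⟩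
  have himg := Filter.image_mem_map (m := G) hnhd
  rw [hmap] at himg
  have hcont : Filter.Tendsto (fun p : P => (p, (0 : E))) (𝓝 p₀) (𝓝 (p₀, 0)) :=
    (Continuous.prodMk_left (0 : E)).tendsto p₀
  filter_upwards [hcont himg] with p hp hpΛ
  obtain ⟨⟨p', x⟩, ⟨hxU, hinj⟩, hx⟩ := hp
  obtain ⟨rfl, hx2⟩ := Prod.mk.inj hx
  refine ⟨x, hxU, hinj _ (hDΦ _ hpΛ x) ?_⟩
  -- Applying `d` to `x - h d x + h Φ = 0` removes the first two terms, leaving `d h Φ = 0`.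
  have h3 : d (x - h (d x) + h (Φ (p', x))) = 0 := by
    have : x - h (d x) + h (Φ (p', x)) = 0 := hx2
    rw [this, map_zero]
  simpa [hh] using h3

/-- The zero set of `Φ (p₀, ·)` is straightened near `0` by a diffeomorphism that has the identity
as its derivative at `0`. -/
theorem exists_straightening (hDΦ : ∀ x, D (p₀, x) (Φ (p₀, x)) = 0) :
    ∃ e : OpenPartialHomeomorph E E, (0 : E) ∈ e.source ∧ e 0 = 0 ∧
      ContDiffOn ℝ ∞ e e.source ∧ ContDiffOn ℝ ∞ e.symm e.target ∧
      HasFDerivAt e.symm (ContinuousLinearMap.id ℝ E) 0 ∧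
      ∀ x ∈ e.source, Φ (p₀, x) = 0 ↔ e x ∈ LinearMap.ker d := by
  obtain ⟨h, hh⟩ := exists_generalizedInverse d
  let hc : C₁ →L[ℝ] E := LinearMap.toContinuousLinearMap h
  let dc : E →L[ℝ] C₁ := LinearMap.toContinuousLinearMap d
  let g : E → E := fun x => x - hc (dc x) + hc (Φ (p₀, x))
  have hι : ContDiff ℝ ∞ (fun x : E => (p₀, x)) := contDiff_const.prodMk contDiff_id
  have hg : ContDiff ℝ ∞ g := by
    refine ContDiff.add (ContDiff.sub contDiff_id ?_) ?_
    · exact hc.contDiff.comp dc.contDiff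
    · exact hc.contDiff.comp (hΦ.comp hι)
  have hg' : HasFDerivAt g (ContinuousLinearEquiv.refl ℝ E : E →L[ℝ] E) 0 := by
    have h1 : HasFDerivAt (fun x : E => Φ (p₀, x)) dc 0 := by
      have h2 : HasFDerivAt Φ (fderiv ℝ Φ (p₀, 0)) (p₀, (0 : E)) :=
        (hΦ.differentiable (by simp) _).hasFDerivAt
      have h3 : HasFDerivAt (fun x : E => (p₀, x)) (ContinuousLinearMap.inr ℝ P E) 0 :=
        hasFDerivAt_prodMk_right p₀ 0
      refine (h2.comp (0 : E) h3).congr_fderiv ?_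
      ext v
      exact hd v
    have h4 : HasFDerivAt g (ContinuousLinearMap.id ℝ E - hc ∘L dc + hc ∘L dc) 0 := by
      refine HasFDerivAt.add (HasFDerivAt.sub (hasFDerivAt_id _) ?_) ?_
      · exact (hc ∘L dc).hasFDerivAt
      · exact hc.hasFDerivAt.comp _ h1
    refine h4.congr_fderiv ?_
    ext v
    simp
  let e₀ := hg.contDiffAt.toOpenPartialHomeomorph g hg' (by simp)
  have he₀ : (e₀ : E → E) = g := hg.contDiffAt.toOpenPartialHomeomorph_coe hg' (by simp)
  have h0s : (0 : E) ∈ e₀.source := hg.contDiffAt.mem_toOpenPartialHomeomorph_source hg' (by simp)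
  have hg0 : g 0 = 0 := by simp [g, hΦ0]
  have hev : ∀ᶠ x in 𝓝 (0 : E), (∀ c, D (p₀, x) c = 0 → d (h c) = 0 → c = 0) :=
    (hι.continuous.tendsto 0).eventually (eventually_eq_zero_of_ker_le D hD (p₀, 0) d hker h hh)
  -- Smoothness of the inverse is needed on the whole target, so the domain is shrunk to where the
  -- derivative of `g` is invertible.
  have hequiv : ∀ᶠ x in 𝓝 (0 : E), fderiv ℝ g x ∈ Set.range ((↑) : (E ≃L[ℝ] E) → E →L[ℝ] E) := by
    refine (hg.continuous_fderiv (by simp)).continuousAt.eventually ?_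
    rw [hg'.fderiv]
    exact ContinuousLinearEquiv.nhds _
  obtain ⟨s, hs, hso, h0⟩ := eventually_nhds_iff.1 (hev.and hequiv)
  let e := e₀.restrOpen s hso
  have he : (e : E → E) = g := he₀
  have hes : e.source = e₀.source ∩ s := e₀.restrOpen_source s hso
  have h0e : (0 : E) ∈ e.source := by rw [hes]; exact ⟨h0s, h0⟩
  have he0 : e 0 = 0 := by rw [he, hg0]
  refine ⟨e, h0e, he0, ?_, ?_, ?_, ?_⟩
  · rw [he]; exact hg.contDiffOn
  · intro y hy
    have hy' := e.map_target hy
    rw [hes] at hy'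
    obtain ⟨f', hf'⟩ := (hs _ hy'.2).2
    refine (e.contDiffAt_symm hy (f₀' := f') ?_ ?_).contDiffWithinAt
    · rw [he, hf']
      exact (hg.differentiable (by simp) _).hasFDerivAt
    · rw [he]
      exact hg.contDiffAt
  · have h0t : (0 : E) ∈ e.target := by
      have := e.map_source h0e
      rwa [he0] at this
    have hs0 : e.symm 0 = 0 := by
      have := e.left_inv h0e
      rwa [he0] at this
    have := e.hasFDerivAt_symm h0t (f' := ContinuousLinearEquiv.refl ℝ E)
      (by rw [hs0, he]; exact hg')
    simpa using this
  · intro x hx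
    rw [hes] at hx
    have h1 : d (e x) = d (h (Φ (p₀, x))) := by
      rw [he]
      change d (x - h (d x) + h (Φ (p₀, x))) = _
      simp [hh]
    rw [LinearMap.mem_ker, h1]
    constructor
    · intro h2
      rw [h2]
      simp
    · intro h2
      exact (hs x hx.2).1 _ (hDΦ x) h2

/-- Every vector in the kernel of `d` is the velocity of a smooth curve of zeros of
`Φ (p₀, ·)`. -/
theorem exists_curve (hDΦ : ∀ x, D (p₀, x) (Φ (p₀, x)) = 0) (v : E) (hv : d v = 0) :
    ∃ c : ℝ → E, ContDiff ℝ ∞ c ∧ c 0 = 0 ∧ HasDerivAt c v 0 ∧ ∀ t, Φ (p₀, c t) = 0 := by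
  obtain ⟨e, h0, he0, -, hsymm, hder, hzero⟩ :=
    exists_straightening Φ hΦ p₀ hΦ0 d hd D hD hker hDΦ
  have h0t : (0 : E) ∈ e.target := by
    have := e.map_source h0
    rwa [he0] at this
  have hmem : ∀ᶠ s in 𝓝 (0 : ℝ), s • v ∈ e.target := by
    have : Filter.Tendsto (fun s : ℝ => s • v) (𝓝 0) (𝓝 ((0 : ℝ) • v)) :=
      (continuous_id.smul continuous_const).tendsto 0
    rw [zero_smul] at this
    exact this (e.open_target.mem_nhds h0t)
  obtain ⟨δ, hδ, hball⟩ := Metric.eventually_nhds_iff.1 hmem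
  set ε := δ / 2 with hε
  have hεpos : 0 < ε := by positivity
  -- A reparametrization with `τ 0 = 0`, `τ' 0 = 1` and `|τ| ≤ ε < δ` keeps the curve in the target
  -- for all times.
  let τ : ℝ → ℝ := fun t => ε * Real.sin (t / ε)
  have hτ : ContDiff ℝ ∞ τ :=
    contDiff_const.mul (Real.contDiff_sin.comp (contDiff_id.div_const ε))
  have hτm : ∀ t, τ t • v ∈ e.target := by
    intro t
    apply hball
    rw [Real.dist_eq, sub_zero, abs_mul, abs_of_pos hεpos]
    have := Real.abs_sin_le_one (t / ε)
    nlinarith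
  have hτ0 : τ 0 = 0 := by simp [τ]
  have hτd : HasDerivAt τ 1 0 := by
    have h1 : HasDerivAt (fun t : ℝ => t / ε) (1 / ε) 0 := (hasDerivAt_id 0).div_const ε
    have h2 := (h1.sin).const_mul ε
    simpa [hεpos.ne'] using h2
  have hsmooth : ContDiff ℝ ∞ (fun t => τ t • v) := hτ.smul contDiff_const
  refine ⟨fun t => e.symm (τ t • v), ?_, ?_, ?_, ?_⟩
  · exact hsymm.comp_contDiff hsmooth hτm
  · have := e.left_inv h0
    simpa [hτ0, he0] using this
  · have h1 : HasDerivAt (fun t => τ t • v) v 0 := by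
      simpa using hτd.smul_const v
    have h2 : HasFDerivAt e.symm (ContinuousLinearMap.id ℝ E) (τ 0 • v) := by
      simpa [hτ0] using hder
    have h3 := h2.comp_hasDerivAt (0 : ℝ) h1
    exact h3
  · intro t
    rw [hzero _ (e.map_target (hτm t)), e.right_inv (hτm t), LinearMap.mem_ker, map_smul, hv,
      smul_zero]

end Straightening

/-! ### The ideal equation in a chart and its Bianchi identity -/

section Obstruction

variable {V : Type*} [AddCommGroup V] [Module ℝ V] {W W' : Submodule ℝ V} (h : IsCompl W W')

/-- The projection onto `W'` along the graph of `φ : W → W'`. -/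
noncomputable def graphProj (φ : W →ₗ[ℝ] W') : V →ₗ[ℝ] W' :=
  W'.projectionOnto W h.symm - φ ∘ₗ W.projectionOnto W' h

/-- For `z = w + w'` this is `z = (w + φ w) + (w' - φ w)`, the decomposition along the graph and
`W'`. -/
theorem graphMap_add_graphProj (φ : W →ₗ[ℝ] W') (z : V) :
    graphMap W W' φ (W.projectionOnto W' h z) + graphProj h φ z = z := by
  have : (W.projectionOnto W' h z : V) + W'.projectionOnto W h.symm z = z :=
    Submodule.projection_add_projection_eq_self h z
  conv_rhs => rw [← this]
  simp [graphMap, graphProj]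

@[simp]
theorem graphProj_graphMap (φ : W →ₗ[ℝ] W') (u : W) :
    graphProj h φ (graphMap W W' φ u) = 0 := by
  simp [graphMap, graphProj]

theorem graphProj_eq_zero_iff (φ : W →ₗ[ℝ] W') (z : V) :
    graphProj h φ z = 0 ↔ z ∈ LinearMap.range (graphMap W W' φ) := by
  constructor
  · intro hz
    refine ⟨W.projectionOnto W' h z, ?_⟩
    simpa [hz] using graphMap_add_graphProj h φ z
  · rintro ⟨u, rfl⟩
    simp

/-- The obstruction for the graph of `φ : W → W'` to be an ideal of `(V, μ)`. -/
noncomputable def obstruction (μ : V →ₗ[ℝ] V →ₗ[ℝ] V) (φ : W →ₗ[ℝ] W') :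
    V →ₗ[ℝ] W →ₗ[ℝ] W' :=
  (μ.compl₂ (graphMap W W' φ)).compr₂ (graphProj h φ)

theorem obstruction_apply (μ : V →ₗ[ℝ] V →ₗ[ℝ] V) (φ : W →ₗ[ℝ] W') (x : V) (u : W) :
    obstruction h μ φ x u = graphProj h φ (μ x (graphMap W W' φ u)) := rfl

theorem obstruction_eq_zero_iff (μ : V →ₗ[ℝ] V →ₗ[ℝ] V) (φ : W →ₗ[ℝ] W') :
    obstruction h μ φ = 0 ↔ ∀ x, ∀ w ∈ LinearMap.range (graphMap W W' φ),
      μ x w ∈ LinearMap.range (graphMap W W' φ) := by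
  constructor
  · rintro h0 x _ ⟨u, rfl⟩
    rw [← graphProj_eq_zero_iff h, ← obstruction_apply, h0]
    rfl
  · intro h0
    ext x u : 2
    exact (graphProj_eq_zero_iff h _ _).2 (h0 x _ ⟨u, rfl⟩)

/-- The linear operator that annihilates the obstruction when `μ` is a Lie bracket. It is the
differential in degree one when `φ = 0` and `W` is an ideal. -/
noncomputable def obstructionD (μ : V →ₗ[ℝ] V →ₗ[ℝ] V) (φ : W →ₗ[ℝ] W') :
    (V →ₗ[ℝ] W →ₗ[ℝ] W') →ₗ[ℝ] V →ₗ[ℝ] V →ₗ[ℝ] W →ₗ[ℝ] W' where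
  toFun T := LinearMap.mk₂ ℝ
    (fun x y => graphProj h φ ∘ₗ μ x ∘ₗ W'.subtype ∘ₗ T y
      + T x ∘ₗ W.projectionOnto W' h ∘ₗ μ y ∘ₗ graphMap W W' φ
      - graphProj h φ ∘ₗ μ y ∘ₗ W'.subtype ∘ₗ T x
      - T y ∘ₗ W.projectionOnto W' h ∘ₗ μ x ∘ₗ graphMap W W' φ
      - T (μ x y))
    (fun _ _ _ => by ext; simp; abel) (fun _ _ _ => by ext; simp [smul_sub])
    (fun _ _ _ => by ext; simp; abel) (fun _ _ _ => by ext; simp [smul_sub])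
  map_add' _ _ := by ext; simp; abel
  map_smul' _ _ := by ext; simp [smul_sub]

theorem obstructionD_apply (μ : V →ₗ[ℝ] V →ₗ[ℝ] V) (φ : W →ₗ[ℝ] W')
    (T : V →ₗ[ℝ] W →ₗ[ℝ] W') (x y : V) (u : W) :
    obstructionD h μ φ T x y u = graphProj h φ (μ x (T y u))
      + T x (W.projectionOnto W' h (μ y (graphMap W W' φ u)))
      - graphProj h φ (μ y (T x u))
      - T y (W.projectionOnto W' h (μ x (graphMap W W' φ u))) - T (μ x y) u := rfl

/-- Project the Jacobi identity for `x`, `y` and a graph vector to `W'`, after splitting each inner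
bracket into its graph part, on which the outer bracket is again an obstruction, and its `W'` part.
-/
theorem obstructionD_obstruction (μ : LieBracket V) (φ : W →ₗ[ℝ] W') :
    obstructionD h μ.1 φ (obstruction h μ.1 φ) = 0 := by
  have key : ∀ x z, graphProj h φ (μ.1 x z) =
      obstruction h μ.1 φ x (W.projectionOnto W' h z) + graphProj h φ (μ.1 x (graphProj h φ z)) := by
    intro x z
    rw [obstruction_apply, ← map_add, ← map_add, graphMap_add_graphProj]
  ext x y u : 3
  have h1 := key x (μ.1 y (graphMap W W' φ u))
  have h2 := key y (μ.1 x (graphMap W W' φ u))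
  rw [μ.2.2 x y, map_add] at h1
  rw [obstructionD_apply]
  simp only [LinearMap.zero_apply]
  simp only [obstruction_apply] at h1 h2 ⊢
  rw [h2] at h1
  rw [← sub_eq_zero] at h1
  rw [← neg_eq_zero, ← h1]
  abel

/-- The differential in degree zero, in terms of `Hom(W, W')` instead of `Hom(W, V ⧸ W)`. -/
noncomputable def obstructionDeriv (μ : V →ₗ[ℝ] V →ₗ[ℝ] V) :
    (W →ₗ[ℝ] W') →ₗ[ℝ] V →ₗ[ℝ] W →ₗ[ℝ] W' :=
  LinearMap.mk₂ ℝ (fun φ x => W'.projectionOnto W h.symm ∘ₗ μ x ∘ₗ W'.subtype ∘ₗ φ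
      - φ ∘ₗ W.projectionOnto W' h ∘ₗ μ x ∘ₗ W.subtype)
    (fun _ _ _ => by ext; simp; abel) (fun _ _ _ => by ext; simp [smul_sub])
    (fun _ _ _ => by ext; simp; abel) (fun _ _ _ => by ext; simp [smul_sub])

theorem obstructionDeriv_apply (μ : V →ₗ[ℝ] V →ₗ[ℝ] V) (φ : W →ₗ[ℝ] W') (x : V) (u : W) :
    obstructionDeriv h μ φ x u = W'.projectionOnto W h.symm (μ x (φ u))
      - φ (W.projectionOnto W' h (μ x u)) := rfl

/-- Along a line, the obstruction is the differential plus a quadratic remainder. -/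
theorem obstruction_smul (μ : V →ₗ[ℝ] V →ₗ[ℝ] V) (hW : ∀ x, ∀ w ∈ W, μ x w ∈ W)
    (φ : W →ₗ[ℝ] W') (t : ℝ) :
    obstruction h μ (t • φ) = t • obstructionDeriv h μ φ
      - t ^ 2 • ((μ.compl₂ (W'.subtype ∘ₗ φ)).compr₂ (φ ∘ₗ W.projectionOnto W' h)) := by
  ext x u : 2
  -- Invariance of `W` kills the term of order zero in `t`.
  have h1 : W'.projectionOnto W h.symm (μ x u) = 0 :=
    (Submodule.projectionOnto_apply_eq_zero_iff h.symm).2 (hW x u u.2)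
  simp only [obstruction_apply, graphProj, graphMap, LinearMap.sub_apply, LinearMap.smul_apply,
    obstructionDeriv_apply, LinearMap.compr₂_apply, LinearMap.compl₂_apply, LinearMap.add_apply,
    LinearMap.comp_apply, Submodule.subtype_apply, map_add, h1, map_smul]
  module

theorem obstruction_zero (μ : V →ₗ[ℝ] V →ₗ[ℝ] V) (hW : ∀ x, ∀ w ∈ W, μ x w ∈ W) :
    obstruction h μ (0 : W →ₗ[ℝ] W') = 0 := by
  have hr : LinearMap.range (graphMap W W' 0) = W := by simp [graphMap]
  rw [obstruction_eq_zero_iff, hr]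
  exact hW

end Obstruction

/-! ### Norm-free smoothness and smoothness of the obstruction -/

section Smoothness

variable {X : Type*} [NormedAddCommGroup X] [NormedSpace ℝ X]
variable {A B : Type*} [AddCommGroup A] [Module ℝ A] [FiniteDimensional ℝ A]
  [AddCommGroup B] [Module ℝ B] [FiniteDimensional ℝ B]

/-- Smoothness of a map into a finite-dimensional real vector space, without choice of norm. -/
def FDContDiff (f : X → A) : Prop :=
  letI := fdNormedAddCommGroup A
  letI := fdNormedSpace A
  ContDiff ℝ ∞ f

namespace FDContDiff

theorem add {f g : X → A} (hf : FDContDiff f) (hg : FDContDiff g) :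
    FDContDiff fun x => f x + g x :=
  letI := fdNormedAddCommGroup A
  letI := fdNormedSpace A
  ContDiff.add hf hg

theorem sub {f g : X → A} (hf : FDContDiff f) (hg : FDContDiff g) :
    FDContDiff fun x => f x - g x :=
  letI := fdNormedAddCommGroup A
  letI := fdNormedSpace A
  ContDiff.sub hf hg

theorem const (a : A) : FDContDiff fun _ : X => a :=
  letI := fdNormedAddCommGroup A
  letI := fdNormedSpace A
  contDiff_const

theorem map (l : A →ₗ[ℝ] B) {f : X → A} (hf : FDContDiff f) : FDContDiff fun x => l (f x) :=
  letI := fdNormedAddCommGroup A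
  letI := fdNormedSpace A
  letI := fdNormedAddCommGroup B
  letI := fdNormedSpace B
  (LinearMap.toContinuousLinearMap l).contDiff.comp hf

theorem apply {f : X → A →ₗ[ℝ] B} {g : X → A} (hf : FDContDiff f) (hg : FDContDiff g) :
    FDContDiff fun x => f x (g x) :=
  letI := fdNormedAddCommGroup A
  letI := fdNormedSpace A
  letI := fdNormedAddCommGroup B
  letI := fdNormedSpace B
  letI := fdNormedAddCommGroup (A →ₗ[ℝ] B)
  letI := fdNormedSpace (A →ₗ[ℝ] B)
  let b : (A →ₗ[ℝ] B) →ₗ[ℝ] A →ₗ[ℝ] B := LinearMap.id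
  (b.toContinuousBilinearMap.contDiff.comp hf).clm_apply hg

/-- In finite dimension an operator-valued map is smooth once its values on each vector are; the
obstruction can then be checked entry by entry. -/
theorem of_apply {f : X → A →ₗ[ℝ] B} (hf : ∀ a, FDContDiff fun x => f x a) : FDContDiff f := by
  let := fdNormedAddCommGroup A
  let := fdNormedSpace A
  let := fdNormedAddCommGroup B
  let := fdNormedSpace B
  let := fdNormedAddCommGroup (A →ₗ[ℝ] B)
  let := fdNormedSpace (A →ₗ[ℝ] B)
  have h1 : ContDiff ℝ ∞ fun x => LinearMap.toContinuousLinearMap (f x) :=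
    contDiff_clm_apply_iff.2 hf
  let l : (A →L[ℝ] B) →ₗ[ℝ] (A →ₗ[ℝ] B) := LinearMap.toContinuousLinearMap.symm.toLinearMap
  exact (LinearMap.toContinuousLinearMap l).contDiff.comp h1

end FDContDiff

theorem FDContDiff.contDiff_iff {f : X → A} :
    letI := fdNormedAddCommGroup A
    letI := fdNormedSpace A
    FDContDiff f ↔ ContDiff ℝ ∞ f := Iff.rfl

end Smoothness

section ObstructionSmoothness

set_option maxSynthPendingDepth 6

variable {V : Type*} [AddCommGroup V] [Module ℝ V] [FiniteDimensional ℝ V]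
  {W W' : Submodule ℝ V} (h : IsCompl W W')
  {X : Type*} [NormedAddCommGroup X] [NormedSpace ℝ X]

theorem FDContDiff.graphMap {f : X → W →ₗ[ℝ] W'} (hf : FDContDiff f) (u : W) :
    FDContDiff fun x => graphMap W W' (f x) u :=
  (FDContDiff.const (u : V)).add ((hf.apply (.const u)).map W'.subtype)

theorem FDContDiff.graphProj {f : X → W →ₗ[ℝ] W'} {g : X → V} (hf : FDContDiff f)
    (hg : FDContDiff g) : FDContDiff fun x => graphProj h (f x) (g x) :=
  (hg.map (W'.projectionOnto W h.symm)).sub (hf.apply (hg.map (W.projectionOnto W' h)))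

theorem FDContDiff.obstruction {m : X → V →ₗ[ℝ] V →ₗ[ℝ] V} {f : X → W →ₗ[ℝ] W'}
    (hm : FDContDiff m) (hf : FDContDiff f) : FDContDiff fun x => obstruction h (m x) (f x) :=
  .of_apply fun x => .of_apply fun u =>
    .graphProj h hf ((hm.apply (.const x)).apply (.graphMap hf u))

theorem FDContDiff.obstructionD {m : X → V →ₗ[ℝ] V →ₗ[ℝ] V} {f : X → W →ₗ[ℝ] W'}
    (hm : FDContDiff m) (hf : FDContDiff f) (T : V →ₗ[ℝ] W →ₗ[ℝ] W') :
    FDContDiff fun x => obstructionD h (m x) (f x) T := by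
  have hm' : ∀ x {g : X → V}, FDContDiff g → FDContDiff fun z => m z x (g z) :=
    fun x g hg => (hm.apply (.const x)).apply hg
  have hgm : ∀ x y u, FDContDiff fun z =>
      T x (W.projectionOnto W' h (m z y (IdealStability.graphMap W W' (f z) u))) :=
    fun x y u => (((hm' y (.graphMap hf u)).map (W.projectionOnto W' h)).map (T x))
  refine .of_apply fun x => .of_apply fun y => .of_apply fun u => ?_
  refine ((((FDContDiff.graphProj h hf (hm' x (.const _))).add (hgm x y u)).sub
    (.graphProj h hf (hm' y (.const _)))).sub (hgm y x u)).sub ?_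
  exact ((hm' x (.const y)).map T).apply (.const u)

end ObstructionSmoothness

/-! ### Stability, straightening and curves in a chart -/

section Charts

set_option maxSynthPendingDepth 6

variable {V : Type*} [AddCommGroup V] [Module ℝ V] [FiniteDimensional ℝ V]
  {W W' : Submodule ℝ V} (h : IsCompl W W') (μ : LieBracket V) (hW : ∀ x, ∀ w ∈ W, μ.1 x w ∈ W)

-- Differentiate along `t ↦ (μ, t • v)`: the remainder in `obstruction_smul` is quadratic in `t` and
-- contributes nothing.
include hW in
theorem fderiv_obstruction (v : W →ₗ[ℝ] W') :
    letI := fdNormedAddCommGroup (V →ₗ[ℝ] V →ₗ[ℝ] V)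
    letI := fdNormedSpace (V →ₗ[ℝ] V →ₗ[ℝ] V)
    letI := fdNormedAddCommGroup (W →ₗ[ℝ] W')
    letI := fdNormedSpace (W →ₗ[ℝ] W')
    letI := fdNormedAddCommGroup (V →ₗ[ℝ] W →ₗ[ℝ] W')
    letI := fdNormedSpace (V →ₗ[ℝ] W →ₗ[ℝ] W')
    fderiv ℝ (fun z : (V →ₗ[ℝ] V →ₗ[ℝ] V) × (W →ₗ[ℝ] W') => obstruction h z.1 z.2) (μ.1, 0) (0, v)
      = obstructionDeriv h μ.1 v := by
  let _ := fdNormedAddCommGroup (V →ₗ[ℝ] V →ₗ[ℝ] V)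
  let _ := fdNormedSpace (V →ₗ[ℝ] V →ₗ[ℝ] V)
  let _ := fdNormedAddCommGroup (W →ₗ[ℝ] W')
  let _ := fdNormedSpace (W →ₗ[ℝ] W')
  let _ := fdNormedAddCommGroup (V →ₗ[ℝ] W →ₗ[ℝ] W')
  let _ := fdNormedSpace (V →ₗ[ℝ] W →ₗ[ℝ] W')
  have hΦ : ContDiff ℝ ∞ (fun z : (V →ₗ[ℝ] V →ₗ[ℝ] V) × (W →ₗ[ℝ] W') => obstruction h z.1 z.2) :=
    FDContDiff.obstruction h contDiff_fst contDiff_snd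
  have hc : HasDerivAt (fun t : ℝ => (μ.1, t • v)) (0, v) 0 := by
    refine (hasDerivAt_const (0 : ℝ) μ.1).prodMk ?_
    simpa using (hasDerivAt_id (0 : ℝ)).smul_const v
  have h1 : HasFDerivAt (fun z : (V →ₗ[ℝ] V →ₗ[ℝ] V) × (W →ₗ[ℝ] W') => obstruction h z.1 z.2)
      (fderiv ℝ (fun z : (V →ₗ[ℝ] V →ₗ[ℝ] V) × (W →ₗ[ℝ] W') => obstruction h z.1 z.2)
        (μ.1, (0 : ℝ) • v)) (μ.1, (0 : ℝ) • v) :=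
    (hΦ.differentiable (by simp) _).hasFDerivAt
  have h2 := h1.comp_hasDerivAt (0 : ℝ) hc
  have h3 : HasDerivAt (fun t : ℝ => obstruction h μ.1 (t • v)) (obstructionDeriv h μ.1 v) 0 := by
    simp_rw [obstruction_smul h μ.1 hW]
    have h4 := ((hasDerivAt_id (0 : ℝ)).smul_const (obstructionDeriv h μ.1 v)).sub
      ((hasDerivAt_pow 2 (0 : ℝ)).smul_const
        ((μ.1.compl₂ (W'.subtype ∘ₗ v)).compr₂ (v ∘ₗ W.projectionOnto W' h)))
    refine HasDerivAt.congr_deriv h4 ?_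
    simp
  rw [zero_smul] at h2
  exact h2.unique h3

/-- The chain rule along a curve of zeros. This is the inclusion of the tangent space in `Z⁰`, and
it needs no exactness. -/
theorem obstructionDeriv_eq_zero_of_hasVelocity (hW : ∀ x, ∀ w ∈ W, μ.1 x w ∈ W)
    {φ : ℝ → W →ₗ[ℝ] W'} {v : W →ₗ[ℝ] W'} {s : Set ℝ}
    (hs : s ∈ 𝓝 0) (hφ0 : φ 0 = 0) (hφ : HasVelocity φ v s 0)
    (hzero : ∀ᶠ t in 𝓝 0, obstruction h μ.1 (φ t) = 0) : obstructionDeriv h μ.1 v = 0 := by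
  let _ := fdNormedAddCommGroup (V →ₗ[ℝ] V →ₗ[ℝ] V)
  let _ := fdNormedSpace (V →ₗ[ℝ] V →ₗ[ℝ] V)
  let _ := fdNormedAddCommGroup (W →ₗ[ℝ] W')
  let _ := fdNormedSpace (W →ₗ[ℝ] W')
  let _ := fdNormedAddCommGroup (V →ₗ[ℝ] W →ₗ[ℝ] W')
  let _ := fdNormedSpace (V →ₗ[ℝ] W →ₗ[ℝ] W')
  have hΦ : ContDiff ℝ ∞ (fun z : (V →ₗ[ℝ] V →ₗ[ℝ] V) × (W →ₗ[ℝ] W') => obstruction h z.1 z.2) :=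
    FDContDiff.obstruction h contDiff_fst contDiff_snd
  have hφ' : HasDerivAt φ v 0 := HasDerivWithinAt.hasDerivAt hφ hs
  have hc : HasDerivAt (fun t : ℝ => (μ.1, φ t)) (0, v) 0 :=
    (hasDerivAt_const (0 : ℝ) μ.1).prodMk hφ'
  have h1 : HasFDerivAt (fun z : (V →ₗ[ℝ] V →ₗ[ℝ] V) × (W →ₗ[ℝ] W') => obstruction h z.1 z.2)
      (fderiv ℝ (fun z : (V →ₗ[ℝ] V →ₗ[ℝ] V) × (W →ₗ[ℝ] W') => obstruction h z.1 z.2)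
        (μ.1, φ 0)) (μ.1, φ 0) :=
    (hΦ.differentiable (by simp) _).hasFDerivAt
  have h2 := h1.comp_hasDerivAt (0 : ℝ) hc
  have h3 : HasDerivAt (fun t : ℝ => obstruction h μ.1 (φ t)) 0 0 :=
    (hasDerivAt_const (0 : ℝ) (0 : V →ₗ[ℝ] W →ₗ[ℝ] W')).congr_of_eventuallyEq hzero
  rw [hφ0] at h2
  rw [← fderiv_obstruction h μ hW]
  exact h2.unique h3

variable (hex : ∀ T, obstructionD h μ.1 0 T = 0 → ∃ φ, obstructionDeriv h μ.1 φ = T)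

include hW hex

theorem eventually_exists_obstruction_eq_zero {U : Set (W →ₗ[ℝ] W')}
    (hU : letI := fdTopology (W →ₗ[ℝ] W'); U ∈ 𝓝 0) :
    ∀ᶠ ν : LieBracket V in 𝓝 μ, ∃ φ ∈ U, obstruction h ν.1 φ = 0 := by
  let _ := fdNormedAddCommGroup (V →ₗ[ℝ] V →ₗ[ℝ] V)
  let _ := fdNormedSpace (V →ₗ[ℝ] V →ₗ[ℝ] V)
  let _ := fdNormedAddCommGroup (W →ₗ[ℝ] W')
  let _ := fdNormedSpace (W →ₗ[ℝ] W')
  let _ := fdNormedAddCommGroup (V →ₗ[ℝ] W →ₗ[ℝ] W')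
  let _ := fdNormedSpace (V →ₗ[ℝ] W →ₗ[ℝ] W')
  let _ := fdNormedAddCommGroup (V →ₗ[ℝ] V →ₗ[ℝ] W →ₗ[ℝ] W')
  let _ := fdNormedSpace (V →ₗ[ℝ] V →ₗ[ℝ] W →ₗ[ℝ] W')
  -- The parameter space is the vector space of all bilinear maps; the Bianchi identity is required
  -- only at Lie brackets, so these need not form a manifold.
  have := eventually_exists_zero (fun z => obstruction h z.1 z.2)
    (FDContDiff.obstruction h contDiff_fst contDiff_snd) μ.1 (obstruction_zero h μ.1 hW)
    (obstructionDeriv h μ.1) (fderiv_obstruction h μ hW) (fun z => obstructionD h z.1 z.2)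
    (fun T => (FDContDiff.contDiff_iff.1
      (FDContDiff.obstructionD h contDiff_fst contDiff_snd T)).continuous) hex
    (Set.range (Subtype.val : LieBracket V → _))
    (by rintro _ ⟨ν, rfl⟩ φ; exact obstructionD_obstruction h ν φ) hU
  have hval : Filter.Tendsto (Subtype.val : LieBracket V → _) (𝓝 μ) (𝓝 μ.1) :=
    continuous_induced_dom.tendsto μ
  filter_upwards [hval this] with ν hν using hν ⟨ν, rfl⟩

theorem isSubmanifoldNear_obstruction_eq_zero :
    IsSubmanifoldNear {φ | obstruction h μ.1 φ = 0} 0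
      (Module.finrank ℝ (LinearMap.ker (obstructionDeriv h μ.1))) := by
  let _ := fdNormedAddCommGroup (V →ₗ[ℝ] V →ₗ[ℝ] V)
  let _ := fdNormedSpace (V →ₗ[ℝ] V →ₗ[ℝ] V)
  let _ := fdNormedAddCommGroup (W →ₗ[ℝ] W')
  let _ := fdNormedSpace (W →ₗ[ℝ] W')
  let _ := fdNormedAddCommGroup (V →ₗ[ℝ] W →ₗ[ℝ] W')
  let _ := fdNormedSpace (V →ₗ[ℝ] W →ₗ[ℝ] W')
  let _ := fdNormedAddCommGroup (V →ₗ[ℝ] V →ₗ[ℝ] W →ₗ[ℝ] W')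
  let _ := fdNormedSpace (V →ₗ[ℝ] V →ₗ[ℝ] W →ₗ[ℝ] W')
  obtain ⟨e, h0, -, he, hsymm, -, hzero⟩ := exists_straightening (fun z => obstruction h z.1 z.2)
    (FDContDiff.obstruction h contDiff_fst contDiff_snd) μ.1 (obstruction_zero h μ.1 hW)
    (obstructionDeriv h μ.1) (fderiv_obstruction h μ hW) (fun z => obstructionD h z.1 z.2)
    (fun T => (FDContDiff.contDiff_iff.1
      (FDContDiff.obstructionD h contDiff_fst contDiff_snd T)).continuous) hex
    (obstructionD_obstruction h μ)
  exact ⟨obstruction_zero h μ.1 hW, e, LinearMap.ker (obstructionDeriv h μ.1), h0, he, hsymm, rfl,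
    hzero⟩

theorem exists_curve_obstruction_eq_zero {v : W →ₗ[ℝ] W'} (hv : obstructionDeriv h μ.1 v = 0) :
    ∃ c : ℝ → W →ₗ[ℝ] W', (∀ s, SmoothOn c s) ∧ c 0 = 0 ∧ (∀ s, HasVelocity c v s 0) ∧
      ∀ t, obstruction h μ.1 (c t) = 0 := by
  let _ := fdNormedAddCommGroup (V →ₗ[ℝ] V →ₗ[ℝ] V)
  let _ := fdNormedSpace (V →ₗ[ℝ] V →ₗ[ℝ] V)
  let _ := fdNormedAddCommGroup (W →ₗ[ℝ] W')
  let _ := fdNormedSpace (W →ₗ[ℝ] W')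
  let _ := fdNormedAddCommGroup (V →ₗ[ℝ] W →ₗ[ℝ] W')
  let _ := fdNormedSpace (V →ₗ[ℝ] W →ₗ[ℝ] W')
  let _ := fdNormedAddCommGroup (V →ₗ[ℝ] V →ₗ[ℝ] W →ₗ[ℝ] W')
  let _ := fdNormedSpace (V →ₗ[ℝ] V →ₗ[ℝ] W →ₗ[ℝ] W')
  obtain ⟨c, hc, hc0, hcd, hzero⟩ := exists_curve (fun z => obstruction h z.1 z.2)
    (FDContDiff.obstruction h contDiff_fst contDiff_snd) μ.1 (obstruction_zero h μ.1 hW)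
    (obstructionDeriv h μ.1) (fderiv_obstruction h μ hW) (fun z => obstructionD h z.1 z.2)
    (fun T => (FDContDiff.contDiff_iff.1
      (FDContDiff.obstructionD h contDiff_fst contDiff_snd T)).continuous) hex
    (obstructionD_obstruction h μ) v hv
  exact ⟨c, fun s => hc.contDiffOn, hc0, fun s => hcd.hasDerivWithinAt, hzero⟩

end Charts

/-! ### Comparison with the Chevalley-Eilenberg complex -/

section Transfer

variable {L : Type*} [LieRing L] [LieAlgebra ℝ L] (I : LieIdeal ℝ L) {W' : Submodule ℝ L}
  (h : IsCompl I.toSubmodule W')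

/-- The identification of `Hom(I, W')` with `Hom(I, L ⧸ I)` for a complement `W'` of `I`. -/
noncomputable def homQuotientEquiv : (I.toSubmodule →ₗ[ℝ] W') ≃ₗ[ℝ] (I →ₗ[ℝ] L ⧸ I) :=
  LinearEquiv.congrRight (Submodule.quotientEquivOfIsCompl I.toSubmodule W' h).symm

/-- `z` and its `W'`-component differ by an element of `I`. -/
theorem mk_projectionOnto (z : L) :
    LieSubmodule.Quotient.mk' I (W'.projectionOnto I.toSubmodule h.symm z : L) =
      LieSubmodule.Quotient.mk' I z := by
  have h1 : (I.toSubmodule.projectionOnto W' h z : L)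
      + W'.projectionOnto I.toSubmodule h.symm z = z :=
    Submodule.projection_add_projection_eq_self h z
  have h2 : LieSubmodule.Quotient.mk' I (I.toSubmodule.projectionOnto W' h z : L) = 0 :=
    (LieSubmodule.Quotient.mk_eq_zero I).2 (I.toSubmodule.projectionOnto W' h z).2
  conv_rhs => rw [← h1, map_add, h2, zero_add]

theorem lie_mem_toSubmodule :
    ∀ x, ∀ w ∈ I.toSubmodule, (bracketOf L).1 x w ∈ I.toSubmodule :=
  fun x _ hw => lie_mem_right ℝ L I x _ hw

theorem projectionOnto_lie (x : L) (u : I.toSubmodule) :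
    I.toSubmodule.projectionOnto W' h ((bracketOf L).1 x (u : L)) =
      ⟨⁅x, (u : L)⁆, lie_mem_toSubmodule I x u u.2⟩ :=
  Submodule.projectionOnto_apply_of_mem_left h (lie_mem_toSubmodule I x u u.2)

theorem homQuotientEquiv_obstructionDeriv (φ : I.toSubmodule →ₗ[ℝ] W') (x : L) :
    homQuotientEquiv I h (obstructionDeriv h (bracketOf L).1 φ x) =
      ⁅x, homQuotientEquiv I h φ⁆ := by
  refine LinearMap.ext fun u : I.toSubmodule => ?_
  have h1 := obstructionDeriv_apply h (bracketOf L).1 φ x u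
  rw [projectionOnto_lie I h x u] at h1
  refine (congrArg (fun c : W' => LieSubmodule.Quotient.mk' I (c : L)) h1).trans ?_
  rw [Submodule.coe_sub, map_sub, mk_projectionOnto I h]
  rfl

/-- At `φ = 0` the graph is `I`, so the two projections become the actions of `L` on `L ⧸ I` and on
`I`. -/
theorem homQuotientEquiv_obstructionD (T : L →ₗ[ℝ] I.toSubmodule →ₗ[ℝ] W') (x y : L) :
    homQuotientEquiv I h (obstructionD h (bracketOf L).1 0 T x y) =
      LieModule.Cohomology.d₁₂ ℝ L (I →ₗ[ℝ] L ⧸ I)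
        ((homQuotientEquiv I h).toLinearMap ∘ₗ T) x y := by
  refine LinearMap.ext fun u : I.toSubmodule => ?_
  have h1 := obstructionD_apply h (bracketOf L).1 0 T x y u
  have hgraph : graphMap I.toSubmodule W' 0 u = (u : L) := by simp [graphMap]
  have hproj : ∀ z, graphProj h 0 z = W'.projectionOnto I.toSubmodule h.symm z := by
    simp [graphProj]
  rw [hgraph, hproj, hproj, projectionOnto_lie I h x u, projectionOnto_lie I h y u] at h1
  refine (congrArg (fun c : W' => LieSubmodule.Quotient.mk' I (c : L)) h1).trans ?_
  simp only [Submodule.coe_sub, Submodule.coe_add, map_sub, map_add, mk_projectionOnto I h]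
  let π := LieSubmodule.Quotient.mk' I
  let xu : I.toSubmodule := ⟨⁅x, (u : L)⁆, lie_mem_toSubmodule I x u u.2⟩
  let yu : I.toSubmodule := ⟨⁅y, (u : L)⁆, lie_mem_toSubmodule I y u u.2⟩
  change π ⁅x, (T y u : L)⁆ + π (T x yu : L) - π ⁅y, (T x u : L)⁆ - π (T y xu : L)
      - π (T ⁅x, y⁆ u : L) =
    (π ⁅x, (T y u : L)⁆ - π (T y xu : L)) - (π ⁅y, (T x u : L)⁆ - π (T x yu : L))
      - π (T ⁅x, y⁆ u : L)
  abel

theorem mem_idealZ0_iff (φ : I.toSubmodule →ₗ[ℝ] W') :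
    homQuotientEquiv I h φ ∈ idealZ0 I ↔ obstructionDeriv h (bracketOf L).1 φ = 0 := by
  constructor
  · intro h0
    ext x : 1
    apply (homQuotientEquiv I h).injective
    rw [homQuotientEquiv_obstructionDeriv]
    rw [LinearMap.zero_apply, map_zero]
    exact LinearMap.congr_fun (LinearMap.mem_ker.1 h0) x
  · intro h0
    refine LinearMap.mem_ker.2 (LinearMap.ext fun x => ?_)
    refine (homQuotientEquiv_obstructionDeriv I h φ x).symm.trans ?_
    rw [h0]
    simp

theorem finrank_ker_obstructionDeriv :
    Module.finrank ℝ (LinearMap.ker (obstructionDeriv h (bracketOf L).1)) =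
      Module.finrank ℝ (idealZ0 I) := by
  have : (LinearMap.ker (obstructionDeriv h (bracketOf L).1)).map
      (homQuotientEquiv I h).toLinearMap = idealZ0 I := by
    ext η
    obtain ⟨φ, rfl⟩ := (homQuotientEquiv I h).surjective η
    rw [mem_idealZ0_iff, Submodule.mem_map]
    constructor
    · rintro ⟨ψ, hψ, h1⟩
      rwa [← (homQuotientEquiv I h).injective h1]
    · exact fun h1 => ⟨φ, h1, rfl⟩
  rw [← this]
  exact (LinearEquiv.finrank_map_eq _ _).symm

/-- The only use of `H¹ = 0`: it becomes the exactness that the analytic lemmas require. -/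
theorem exists_obstructionDeriv_eq (hH1 : Subsingleton (idealH1 I))
    (T : L →ₗ[ℝ] I.toSubmodule →ₗ[ℝ] W') (hT : obstructionD h (bracketOf L).1 0 T = 0) :
    ∃ φ, obstructionDeriv h (bracketOf L).1 φ = T := by
  have hc : (homQuotientEquiv I h).toLinearMap ∘ₗ T ∈ oneCocycles L (I →ₗ[ℝ] L ⧸ I) := by
    refine LinearMap.mem_ker.2 (Subtype.ext (LinearMap.ext fun x => LinearMap.ext fun y => ?_))
    refine (homQuotientEquiv_obstructionD I h T x y).symm.trans ?_
    rw [hT]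
    simp
  have htop := Submodule.Quotient.subsingleton_iff.1 hH1
  have hmem : (⟨_, hc⟩ : oneCocycles L (I →ₗ[ℝ] L ⧸ I)) ∈
      (LinearMap.range (d₀₁ L (I →ₗ[ℝ] L ⧸ I))).submoduleOf (oneCocycles L (I →ₗ[ℝ] L ⧸ I)) := by
    rw [htop]
    trivial
  obtain ⟨ψ, hψ⟩ := hmem
  obtain ⟨φ, rfl⟩ := (homQuotientEquiv I h).surjective ψ
  refine ⟨φ, LinearMap.ext fun x => (homQuotientEquiv I h).injective ?_⟩
  rw [homQuotientEquiv_obstructionDeriv]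
  exact LinearMap.congr_fun hψ x

end Transfer

/-! ### Charts of the Grassmannian -/

section Grassmannian

variable {V : Type*} [AddCommGroup V] [Module ℝ V] {k : ℕ} (W : Gr k V) (W' : Submodule ℝ V)
  (h : IsCompl W.1 W')

theorem grChart_zero : grChart W W' h 0 = W := by
  apply Subtype.ext
  simp [grChart, graphMap]

theorem grChart_mem_idealsOf_iff (μ : LieBracket V) (φ : W.1 →ₗ[ℝ] W') :
    grChart W W' h φ ∈ idealsOf μ k ↔ obstruction h μ.1 φ = 0 :=
  (obstruction_eq_zero_iff h μ.1 φ).symm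

/-- Stability needs only this about the topology: neighbourhoods pull back to the chart. Openness of
charts plays no role. -/
theorem continuous_grChart [FiniteDimensional ℝ V] :
    letI := fdTopology (W.1 →ₗ[ℝ] W')
    Continuous (grChart W W' h) := by
  let _ := fdTopology (W.1 →ₗ[ℝ] W')
  rw [continuous_iff_coinduced_le]
  exact le_iSup_of_le W (le_iSup_of_le W' (le_iSup_of_le h le_rfl))

end Grassmannian

end IdealStability

/-! ### The four conclusions -/

theorem theorem6 {𝔤 : Type*} [LieRing 𝔤] [LieAlgebra ℝ 𝔤] [FiniteDimensional ℝ 𝔤]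
    (𝔦 : LieIdeal ℝ 𝔤) (hH1 : Subsingleton (idealH1 𝔦)) :
    IsTopologicallyStable 𝔦 ∧
    GrIsSubmanifoldNear (idealsOf (bracketOf 𝔤) (Module.finrank ℝ 𝔦)) (grPoint 𝔦)
      (Module.finrank ℝ (idealZ0 𝔦)) ∧
    grTangentSpace (idealsOf (bracketOf 𝔤) (Module.finrank ℝ 𝔦)) (grPoint 𝔦) =
      (idealZ0 𝔦 : Set (𝔦 →ₗ[ℝ] 𝔤 ⧸ 𝔦)) ∧
    ∀ η ∈ idealZ0 𝔦, IsDeformationClass 𝔦 η := by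
  have hW := lie_mem_toSubmodule 𝔦
  obtain ⟨W', h⟩ := Submodule.exists_isCompl (grPoint 𝔦).1
  -- A curve of ideals defined for all times serves both for tangent vectors on `(-ε, ε)` and for
  -- deformations on `[0, 1]`.
  have hcurve : ∀ η ∈ idealZ0 𝔦, ∃ γ : ℝ → Gr (Module.finrank ℝ 𝔦) 𝔤,
      (∀ s, GrSmoothOn γ s) ∧ (∀ t, γ t ∈ idealsOf (bracketOf 𝔤) (Module.finrank ℝ 𝔦)) ∧
      ∀ s, GrHasVelocity γ s (grPoint 𝔦) η := by
    intro η hη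
    obtain ⟨v, rfl⟩ := (homQuotientEquiv 𝔦 h).surjective η
    replace hη := (mem_idealZ0_iff 𝔦 h v).1 hη
    obtain ⟨c, hc, hc0, hcv, hzero⟩ := exists_curve_obstruction_eq_zero h (bracketOf 𝔤) hW
      (exists_obstructionDeriv_eq 𝔦 h hH1) hη
    refine ⟨fun t => grChart (grPoint 𝔦) W' h (c t), fun s t₀ _ => ?_, fun t => ?_, fun s => ?_⟩
    · exact ⟨grPoint 𝔦, W', h, c, Set.univ, Filter.univ_mem, hc _, fun _ _ => rfl⟩
    · exact (grChart_mem_idealsOf_iff _ _ h _ _).2 (hzero t)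
    · refine ⟨(congrArg (grChart _ W' h) hc0).trans (grChart_zero _ W' h), W', h, c, v,
        .of_forall fun _ => rfl, hc0, hcv s, rfl⟩
  refine ⟨fun U hU => ?_, ⟨hW, fun W'' h'' => ?_⟩, ?_, fun η hη => ?_⟩
  · let _ := fdTopology ((grPoint 𝔦).1 →ₗ[ℝ] W')
    have hU' : grChart (grPoint 𝔦) W' h ⁻¹' U ∈ 𝓝 0 :=
      (continuous_grChart (grPoint 𝔦) W' h).continuousAt.preimage_mem_nhds
        (by rwa [grChart_zero])
    refine ⟨_, eventually_exists_obstruction_eq_zero h (bracketOf 𝔤) hW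
      (exists_obstructionDeriv_eq 𝔦 h hH1) hU', ?_⟩
    rintro μ ⟨φ, hφ, hμ⟩
    exact ⟨_, hφ, (grChart_mem_idealsOf_iff _ _ h _ _).2 hμ⟩
  · have h1 := isSubmanifoldNear_obstruction_eq_zero h'' (bracketOf 𝔤) hW
      (exists_obstructionDeriv_eq 𝔦 h'' hH1)
    have hfin := finrank_ker_obstructionDeriv 𝔦 h''
    have h2 : grChart (grPoint 𝔦) W'' h'' ⁻¹' idealsOf (bracketOf 𝔤) (Module.finrank ℝ 𝔦) =
        {φ | obstruction h'' (bracketOf 𝔤).1 φ = 0} :=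
      Set.ext fun φ => grChart_mem_idealsOf_iff _ _ h'' _ _
    rw [h2, ← hfin]
    exact h1
  · refine Set.Subset.antisymm ?_ fun η hη => ?_
    -- The velocity comes with its own complement `W''`, so the comparison with `Z⁰` is made in that
    -- chart.
    · rintro η ⟨γ, ε, hε, -, hγ, -, W'', h'', φ, v, hφ, hφ0, hv, rfl⟩
      have hs : Set.Ioo (-ε) ε ∈ 𝓝 (0 : ℝ) := Ioo_mem_nhds (neg_lt_zero.2 hε) hε
      rw [nhdsWithin_eq_nhds.2 hs] at hφ
      refine (mem_idealZ0_iff 𝔦 h'' v).2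
        (obstructionDeriv_eq_zero_of_hasVelocity h'' (bracketOf 𝔤) hW hs hφ0 hv ?_)
      filter_upwards [hφ, hs] with t h1 h2
      rw [← grChart_mem_idealsOf_iff, ← h1]
      exact hγ t h2
    · obtain ⟨γ, h1, h2, h3⟩ := hcurve η hη
      exact ⟨γ, 1, one_pos, h1 _, fun t _ => h2 t, h3 _⟩
  · obtain ⟨γ, h1, h2, h3⟩ := hcurve η hη
    exact ⟨γ, ⟨h1 _, (h3 Set.univ).1, fun t _ => h2 t⟩, h3 _⟩
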